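/- Let $\Bbbk$ be a field of characteristic zero and let $\Omega$ be a set. An algebra is a linear space over $\Bbbk$ with bilinear operations $\circ_\omega$, $\omega\in\Omega$. Let $\mathfrak M$ be a variety of such algebras, let $A\in\mathfrak M$, and let $M$ be an $\mathfrak M$-bimodule over $A$. That is, $M$ is a linear space with linear maps $l_\omega: A\otimes M\to M$ and $r_\omega: M\otimes A\to M$ such that the split null extension $A\ltimes M$ belongs to $\mathfrak M$; here $A\ltimes M$ is the space $A\oplus M$ with the operations \[ (a+u)\circ_\omega(b+v)=a\circ_\omega b+l_\omega(a,v)+r_\omega(u,b),\qquad a,b\in A,\ u,v\in M. \] Let $A\rightthreetimes M$ be the space $A\oplus M$ with the doubled family of operations \[ (a+u)\vdash_\omega(b+v)=a\circ_\omega b+l_\omega(a,v),\qquad (a+u)\dashv_\omega(b+v)=a\circ_\omega b+r_\omega(u,b). \] Let $Z=\mathrm{pre}\text{-}\mathrm{Com}\langle z_1,\dots,z_m\rangle$, $m\ge 1$, be the free pre-commutative algebra on $m$ generators, i.e. the free algebra in the variety of algebras with one bilinear operation defined by the identity $(xy+yx)z=x(yz)$, and let $Z\boxtimes(A\rightthreetimes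 M)$ be the space $Z\otimes(A\rightthreetimes M)$ with the operations \[ (z\otimes p)\circ_\omega(w\otimes q)=zw\otimes(p\vdash_\omega q)+wz\otimes(p\dashv_\omega q),\qquad z,w\in Z,\ p,q\in A\rightthreetimes M. \] Then \[ \mathrm{Var}\bigl(Z\boxtimes(A\rightthreetimes M)\bigr)=\mathrm{Var}(A\ltimes M), \] where $\mathrm{Var}(B)$ denotes the variety generated by the algebra $B$, i.e. the class of all algebras that satisfy all identities of $B$. -/

import Mathlib

universe u v w w₁ w₂ x

noncomputable section

open scoped TensorProduct

namespace VarAlg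

/-- An algebra over `k` in the signature `Ω`: a linear space with a family of bilinear
operations `op ω`, `ω : Ω`; no further laws. -/
structure OpAlg (k : Type u) [Field k] (Ω : Type v) where
  carrier : Type w
  [addCommGroup : AddCommGroup carrier]
  [module : Module k carrier]
  op : Ω → carrier →ₗ[k] carrier →ₗ[k] carrier

attribute [instance] OpAlg.addCommGroup OpAlg.module

instance (k : Type u) [Field k] (Ω : Type v) : CoeSort (OpAlg.{u, v, w} k Ω) (Type w) :=
  ⟨OpAlg.carrier⟩

/-- An algebra over `k` with the doubled family of bilinear operations
`⊢_ω` (`vdash ω`) and `⊣_ω` (`dashv ω`), `ω : Ω`. -/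
structure DiAlg (k : Type u) [Field k] (Ω : Type v) where
  carrier : Type w
  [addCommGroup : AddCommGroup carrier]
  [module : Module k carrier]
  vdash : Ω → carrier →ₗ[k] carrier →ₗ[k] carrier
  dashv : Ω → carrier →ₗ[k] carrier →ₗ[k] carrier

attribute [instance] DiAlg.addCommGroup DiAlg.module

instance (k : Type u) [Field k] (Ω : Type v) : CoeSort (DiAlg.{u, v, w} k Ω) (Type w) :=
  ⟨DiAlg.carrier⟩

/-! ### Polynomials, identities, varieties -/

/-- Non-associative monomials in the variables `X` with operation symbols `Ω`. -/
inductive Monomial (Ω : Type v) (X : Type x) : Type (max v x) where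
  | var : X → Monomial Ω X
  | op : Ω → Monomial Ω X → Monomial Ω X → Monomial Ω X

/-- The value of a monomial in the algebra `A`, when the variables take the values `a`. -/
def Monomial.eval {k : Type u} [Field k] {Ω : Type v} {X : Type x} (A : OpAlg.{u, v, w} k Ω)
    (a : X → A) : Monomial Ω X → A
  | .var i => a i
  | .op ω s t => A.op ω (Monomial.eval A a s) (Monomial.eval A a t)

/-- The bilinear operation on formal linear combinations of monomials that extends
`(s, t) ↦ s ∘_ω t`. -/
def polyOp (k : Type u) [Field k] {Ω : Type v} {X : Type x} (ω : Ω) :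
    (Monomial Ω X →₀ k) →ₗ[k] (Monomial Ω X →₀ k) →ₗ[k] (Monomial Ω X →₀ k) :=
  Finsupp.linearCombination k
    (fun s : Monomial Ω X => Finsupp.lmapDomain k k (Monomial.op ω s))

theorem polyOp_single {k : Type u} [Field k] {Ω : Type v} {X : Type x} (ω : Ω)
    (s t : Monomial Ω X) (a b : k) :
    polyOp k ω (Finsupp.single s a) (Finsupp.single t b) =
      Finsupp.single (Monomial.op ω s t) (a * b) := by
  simp only [polyOp, Finsupp.linearCombination_single, LinearMap.smul_apply,
    Finsupp.lmapDomain_apply, Finsupp.mapDomain_single, Finsupp.smul_single, smul_eq_mul]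

/-- The free algebra `Alg⟨X⟩` on `X` in the signature `Ω`: its elements are the polynomials,
that is, the formal linear combinations of monomials. -/
def polyAlg (k : Type u) [Field k] (Ω : Type v) (X : Type x) :
    OpAlg.{u, v, max u v x} k Ω where
  carrier := Monomial Ω X →₀ k
  op ω := polyOp k ω

/-- A variable, as a polynomial. -/
def polyVar (k : Type u) [Field k] (Ω : Type v) {X : Type x} (i : X) : polyAlg k Ω X :=
  Finsupp.single (Monomial.var i) (1 : k)

/-- The value `f(a)` of a polynomial `f` in the algebra `A`. -/
def evalPoly {k : Type u} [Field k] {Ω : Type v} {X : Type x} (A : OpAlg.{u, v, w} k Ω)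
    (a : X → A) : polyAlg k Ω X →ₗ[k] A :=
  Finsupp.linearCombination k (fun t : Monomial Ω X => t.eval A a)

/-- `f = 0` is an identity on the algebra `A`. -/
def IsIdentity {k : Type u} [Field k] {Ω : Type v} (A : OpAlg.{u, v, w} k Ω)
    (f : polyAlg k Ω ℕ) : Prop :=
  ∀ a : ℕ → A, evalPoly A a f = 0

/-- The variety of algebras defined by the identities `f = 0`, `f ∈ E`. -/
def variety {k : Type u} [Field k] {Ω : Type v} (E : Set (polyAlg k Ω ℕ)) :
    Set (OpAlg.{u, v, w} k Ω) :=
  {A | ∀ f ∈ E, IsIdentity A f}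

/-- `Var(A)`, the variety generated by `A`: the class of all algebras (in any chosen universe)
on which all identities of `A` hold. -/
def Var {k : Type u} [Field k] {Ω : Type v} (A : OpAlg.{u, v, w₁} k Ω) :
    Set (OpAlg.{u, v, w} k Ω) :=
  variety {f | IsIdentity A f}

/-! ### Free algebras of varieties -/

/-- A two-sided ideal of an algebra. -/
def IsIdeal {k : Type u} [Field k] {Ω : Type v} (A : OpAlg.{u, v, w} k Ω)
    (I : Submodule k A) : Prop :=
  ∀ (ω : Ω) (a b : A), a ∈ I → A.op ω a b ∈ I ∧ A.op ω b a ∈ I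

/-- The least ideal of `Alg⟨X⟩` that contains all values on `Alg⟨X⟩` of the polynomials in `E`. -/
def identityIdeal {k : Type u} [Field k] {Ω : Type v} (E : Set (polyAlg k Ω ℕ)) (X : Type x) :
    Submodule k (polyAlg k Ω X) :=
  sInf {I | IsIdeal (polyAlg k Ω X) I ∧
    ∀ f ∈ E, ∀ s : ℕ → polyAlg k Ω X, evalPoly (polyAlg k Ω X) s f ∈ I}

theorem isIdeal_identityIdeal {k : Type u} [Field k] {Ω : Type v} (E : Set (polyAlg k Ω ℕ))
    (X : Type x) : IsIdeal (polyAlg k Ω X) (identityIdeal E X) := by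
  intro ω a b ha
  simp only [identityIdeal, Submodule.mem_sInf] at ha ⊢
  exact ⟨fun I hI => (hI.1 ω a b (ha I hI)).1, fun I hI => (hI.1 ω a b (ha I hI)).2⟩

/-- The quotient of an algebra by an ideal. -/
def quotAlg {k : Type u} [Field k] {Ω : Type v} (A : OpAlg.{u, v, w} k Ω)
    (I : Submodule k A) (hI : IsIdeal A I) : OpAlg.{u, v, w} k Ω where
  carrier := A ⧸ I
  op ω := I.liftQ
    (LinearMap.flip (I.liftQ ((A.op ω).compr₂ I.mkQ).flip (by
      intro b hb
      rw [LinearMap.mem_ker]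
      ext a
      simpa using (hI ω b a hb).2)))
    (by
      intro a ha
      rw [LinearMap.mem_ker]
      ext b
      simpa using (hI ω a b ha).1)

theorem quotAlg_op_mk {k : Type u} [Field k] {Ω : Type v} (A : OpAlg.{u, v, w} k Ω)
    (I : Submodule k A) (hI : IsIdeal A I) (ω : Ω) (a b : A) :
    (quotAlg A I hI).op ω (I.mkQ a) (I.mkQ b) = I.mkQ (A.op ω a b) := rfl

/-- The free algebra on `X` in the variety defined by the identities `E`. -/
def freeAlg {k : Type u} [Field k] {Ω : Type v} (E : Set (polyAlg k Ω ℕ)) (X : Type x) :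
    OpAlg.{u, v, max u v x} k Ω :=
  quotAlg (polyAlg k Ω X) (identityIdeal E X) (isIdeal_identityIdeal E X)

/-! ### Pre-commutative algebras and the product `Z ⊠ D` -/

/-- The defining identity `(x y + y x) z = x (y z)` of pre-commutative (Zinbiel) algebras,
which have one bilinear operation. -/
def preComIdentities (k : Type u) [Field k] : Set (polyAlg k Unit ℕ) :=
  let mul := (polyAlg k Unit ℕ).op ()
  let X : ℕ → polyAlg k Unit ℕ := polyVar k Unit
  {mul (mul (X 0) (X 1) + mul (X 1) (X 0)) (X 2) - mul (X 0) (mul (X 1) (X 2))}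

/-- The free pre-commutative algebra `pre-Com⟨z_1, …, z_m⟩`. -/
def freePreCom (k : Type u) [Field k] (m : ℕ) : OpAlg.{u, 0, u} k Unit :=
  freeAlg (preComIdentities k) (Fin m)

/-- `Z ⊠ D`: the space `Z ⊗ D` with the operations
`(z ⊗ a) ∘_ω (w ⊗ b) = zw ⊗ (a ⊢_ω b) + wz ⊗ (a ⊣_ω b)`. -/
abbrev boxtimes {k : Type u} [Field k] {Ω : Type v} (Z : OpAlg.{u, 0, w₁} k Unit)
    (D : DiAlg.{u, v, w₂} k Ω) : OpAlg.{u, v, max w₁ w₂} k Ω where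
  carrier := Z ⊗[k] D
  op ω := TensorProduct.map₂ (Z.op ()) (D.vdash ω) +
    TensorProduct.map₂ (Z.op ()).flip (D.dashv ω)

theorem boxtimes_op_tmul {k : Type u} [Field k] {Ω : Type v} (Z : OpAlg.{u, 0, w₁} k Unit)
    (D : DiAlg.{u, v, w₂} k Ω) (ω : Ω) (z w : Z) (a b : D) :
    (boxtimes Z D).op ω (z ⊗ₜ[k] a) (w ⊗ₜ[k] b) =
      (Z.op () z w ⊗ₜ[k] D.vdash ω a b + Z.op () w z ⊗ₜ[k] D.dashv ω a b : Z ⊗[k] D) := rfl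

/-! ### Bimodules, split null extensions, one-sided dialgebras -/

/-- The data of a bimodule over `A`: a linear space with linear maps `l_ω : A ⊗ M → M` and
`r_ω : M ⊗ A → M`. -/
structure BimodData {k : Type u} [Field k] {Ω : Type v} (A : OpAlg.{u, v, w₁} k Ω) where
  carrier : Type w₂
  [addCommGroup : AddCommGroup carrier]
  [module : Module k carrier]
  l : Ω → A →ₗ[k] carrier →ₗ[k] carrier
  r : Ω → carrier →ₗ[k] A →ₗ[k] carrier

attribute [instance] BimodData.addCommGroup BimodData.module

instance {k : Type u} [Field k] {Ω : Type v} (A : OpAlg.{u, v, w₁} k Ω) :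
    CoeSort (BimodData.{u, v, w₁, w₂} A) (Type w₂) :=
  ⟨BimodData.carrier⟩

/-- The split null extension `A ⋉ M`: the space `A ⊕ M` with
`(a + u) ∘_ω (b + v) = a ∘_ω b + l_ω(a, v) + r_ω(u, b)`. -/
abbrev splitNull {k : Type u} [Field k] {Ω : Type v} (A : OpAlg.{u, v, w₁} k Ω)
    (M : BimodData.{u, v, w₁, w₂} A) : OpAlg.{u, v, max w₁ w₂} k Ω where
  carrier := A × M
  op ω := LinearMap.mk₂ k
    (fun p q => (A.op ω p.1 q.1, M.l ω p.1 q.2 + M.r ω p.2 q.1))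
    (by intros; ext <;> simp [add_add_add_comm])
    (by intros; ext <;> simp)
    (by intros; ext <;> simp [add_add_add_comm])
    (by intros; ext <;> simp)

/-- The one-sided dialgebra `A ⋌ M`: the space `A ⊕ M` with
`(a + u) ⊢_ω (b + v) = a ∘_ω b + l_ω(a, v)` and `(a + u) ⊣_ω (b + v) = a ∘_ω b + r_ω(u, b)`. -/
abbrev oneSided {k : Type u} [Field k] {Ω : Type v} (A : OpAlg.{u, v, w₁} k Ω)
    (M : BimodData.{u, v, w₁, w₂} A) : DiAlg.{u, v, max w₁ w₂} k Ω where
  carrier := A × M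
  vdash ω := LinearMap.mk₂ k
    (fun p q => (A.op ω p.1 q.1, M.l ω p.1 q.2))
    (by intros; ext <;> simp)
    (by intros; ext <;> simp)
    (by intros; ext <;> simp)
    (by intros; ext <;> simp)
  dashv ω := LinearMap.mk₂ k
    (fun p q => (A.op ω p.1 q.1, M.r ω p.2 q.1))
    (by intros; ext <;> simp)
    (by intros; ext <;> simp)
    (by intros; ext <;> simp)
    (by intros; ext <;> simp)

/-- `M` is a bimodule over `A` in the variety defined by `E` (in the sense of Eilenberg):
the split null extension `A ⋉ M` belongs to this variety. -/
def IsBimodule {k : Type u} [Field k] {Ω : Type v} (E : Set (polyAlg k Ω ℕ))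
    {A : OpAlg.{u, v, w₁} k Ω} (M : BimodData.{u, v, w₁, w₂} A) : Prop :=
  splitNull A M ∈ variety E

end VarAlg

end

/-! Var is determined by the identities of the algebra, so it suffices that both algebras satisfy
the same identities; each direction comes from a homomorphism.

From `splitNull` to `boxtimes`: a pre-commutative Z is commutative and associative under zw + wz,
and left multiplications make Z a module over that algebra. Let C be the unitization of the split
null extension Z ⊕ Z (`ComDouble`). Sending z ⊗ (a + u) to (z, 0) ⊗ a + (0, z) ⊗ u embeds Z ⊠ (A ⋌
M) into C ⊗ (A ⋉ M) (`isHom_boxtimesEmb`, `boxtimesEmb_injective`), and over an infinite field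
extension of scalars preserves identities (`IsIdentity.scalarExt`).

Conversely, map the generators of Z to x in x k[x] with product ∫₀ˣ f g'. The functionals ε = f(1)
and δ = f'(1) give a surjection z ⊗ (a + u) ↦ ε(z) a + δ(z) u onto A ⋉ M (`isHom_boxtimesProj`,
`boxtimesProj_surjective`). -/

noncomputable section

open scoped TensorProduct

namespace VarAlg

/-! ### Homomorphisms and identities -/

/-- A linear map that preserves all operations. -/
def IsHom {k : Type u} [Field k] {Ω : Type v} {A : OpAlg.{u, v, w₁} k Ω} {B : OpAlg.{u, v, w₂} k Ω}
    (φ : A →ₗ[k] B) : Prop :=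
  ∀ (ω : Ω) (a b : A), φ (A.op ω a b) = B.op ω (φ a) (φ b)

theorem IsHom.map_monomial {k : Type u} [Field k] {Ω : Type v} {A : OpAlg.{u, v, w₁} k Ω}
    {B : OpAlg.{u, v, w₂} k Ω} {φ : A →ₗ[k] B} (hφ : IsHom φ) {X : Type x} (a : X → A)
    (t : Monomial Ω X) : φ (t.eval A a) = t.eval B (fun i => φ (a i)) := by
  induction t with
  | var i => rfl
  | op ω s t hs ht => simp only [Monomial.eval, hφ ω, hs, ht]

theorem IsHom.map_evalPoly {k : Type u} [Field k] {Ω : Type v} {A : OpAlg.{u, v, w₁} k Ω}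
    {B : OpAlg.{u, v, w₂} k Ω} {φ : A →ₗ[k] B} (hφ : IsHom φ) {X : Type x} (a : X → A)
    (f : polyAlg k Ω X) : φ (evalPoly A a f) = evalPoly B (fun i => φ (a i)) f := by
  simp only [evalPoly]
  erw [Finsupp.apply_linearCombination]
  congr 2
  funext t
  exact hφ.map_monomial a t

theorem IsHom.isIdentity_of_surjective {k : Type u} [Field k] {Ω : Type v}
    {A : OpAlg.{u, v, w₁} k Ω} {B : OpAlg.{u, v, w₂} k Ω} {φ : A →ₗ[k] B} (hφ : IsHom φ)
    (hs : Function.Surjective φ) {f : polyAlg k Ω ℕ} (hf : IsIdentity A f) : IsIdentity B f := by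
  intro b
  choose a ha using fun i => hs (b i)
  have h := hφ.map_evalPoly a f
  simp only [ha] at h
  rw [← h, hf a, map_zero]

theorem IsHom.isIdentity_of_injective {k : Type u} [Field k] {Ω : Type v}
    {A : OpAlg.{u, v, w₁} k Ω} {B : OpAlg.{u, v, w₂} k Ω} {φ : A →ₗ[k] B} (hφ : IsHom φ)
    (hi : Function.Injective φ) {f : polyAlg k Ω ℕ} (hf : IsIdentity B f) : IsIdentity A f := by
  intro a
  apply hi
  rw [hφ.map_evalPoly, hf, map_zero]

theorem evalPoly_single {k : Type u} [Field k] {Ω : Type v} {X : Type x} (A : OpAlg.{u, v, w} k Ω)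
    (a : X → A) (t : Monomial Ω X) (c : k) :
    evalPoly A a (Finsupp.single t c) = c • t.eval A a :=
  Finsupp.linearCombination_single k c t

theorem evalPoly_polyVar {k : Type u} [Field k] {Ω : Type v} {X : Type x}
    (A : OpAlg.{u, v, w} k Ω) (a : X → A) (i : X) : evalPoly A a (polyVar k Ω i) = a i :=
  (evalPoly_single A a _ 1).trans (one_smul k _)

theorem isHom_evalPoly {k : Type u} [Field k] {Ω : Type v} {X : Type x} (A : OpAlg.{u, v, w} k Ω)
    (a : X → A) : IsHom (A := polyAlg k Ω X) (evalPoly A a) := by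
  intro ω p q
  have h : ((polyAlg k Ω X).op ω).compr₂ (evalPoly A a) =
      (A.op ω).compl₁₂ (evalPoly A a) (evalPoly A a) := by
    refine Finsupp.lhom_ext' fun s => LinearMap.ext_ring (Finsupp.lhom_ext' fun t =>
      LinearMap.ext_ring ?_)
    change evalPoly A a (polyOp k ω (Finsupp.single s 1) (Finsupp.single t 1)) =
      A.op ω (evalPoly A a (Finsupp.single s (1 : k))) (evalPoly A a (Finsupp.single t (1 : k)))
    rw [polyOp_single, evalPoly_single, evalPoly_single, evalPoly_single]
    simp [Monomial.eval]
  exact LinearMap.congr_fun₂ h p q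

/-! ### Extension of scalars -/

/-- The algebra `C ⊗ B` over `k`, for a commutative associative algebra `C`. -/
abbrev scalarExt {k : Type u} [Field k] {Ω : Type v} (C : Type w₁) [CommRing C] [Algebra k C]
    (B : OpAlg.{u, v, w₂} k Ω) : OpAlg.{u, v, max w₁ w₂} k Ω where
  carrier := C ⊗[k] B
  op ω := TensorProduct.map₂ (LinearMap.mul k C) (B.op ω)

theorem isHom_of_tmul {k : Type u} [Field k] {Ω : Type v} {V : Type w} {W : Type x}
    [AddCommGroup V] [Module k V] [AddCommGroup W] [Module k W]
    (p : Ω → V ⊗[k] W →ₗ[k] V ⊗[k] W →ₗ[k] V ⊗[k] W) (B : OpAlg.{u, v, w₂} k Ω)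
    (φ : V ⊗[k] W →ₗ[k] B)
    (h : ∀ ω v a v' a', φ (p ω (v ⊗ₜ a) (v' ⊗ₜ a')) = B.op ω (φ (v ⊗ₜ a)) (φ (v' ⊗ₜ a'))) :
    IsHom (A := ⟨V ⊗[k] W, p⟩) φ := by
  intro ω P Q
  have : (p ω).compr₂ φ = (B.op ω).compl₁₂ φ φ := by
    ext v a v' a'
    exact h ω v a v' a'
  exact LinearMap.congr_fun₂ this P Q

theorem isHom_rTensor {k : Type u} [Field k] {Ω : Type v} {C : Type w₁} [CommRing C]
    [Algebra k C] {C' : Type w} [CommRing C'] [Algebra k C'] (φ : C →ₐ[k] C')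
    (B : OpAlg.{u, v, w₂} k Ω) :
    IsHom (A := scalarExt C B) (B := scalarExt C' B) (φ.toLinearMap.rTensor B) :=
  isHom_of_tmul _ _ _ fun ω c a d b => by
    simp [TensorProduct.map₂_apply_tmul]

theorem isHom_lid_rTensor {k : Type u} [Field k] {Ω : Type v} {C : Type w₁} [CommRing C]
    [Algebra k C] (φ : C →ₐ[k] k) (B : OpAlg.{u, v, w₂} k Ω) :
    IsHom (A := scalarExt C B) (B := B)
      ((TensorProduct.lid k B).toLinearMap ∘ₗ φ.toLinearMap.rTensor B) :=
  isHom_of_tmul _ _ _ fun ω c a d b => by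
    simp [TensorProduct.map₂_apply_tmul, smul_smul, mul_comm]

/-- A polynomial with vector coefficients over an infinite field is determined by its values. -/
theorem eq_zero_of_lid_rTensor_aeval {k : Type u} [Field k] [Infinite k] {σ : Type w₁}
    {V : Type w₂} [AddCommGroup V] [Module k V] (F : MvPolynomial σ k ⊗[k] V)
    (h : ∀ t : σ → k, TensorProduct.lid k V ((MvPolynomial.aeval t).toLinearMap.rTensor V F) = 0) :
    F = 0 := by
  classical
  let b := Module.Basis.ofVectorSpace k V
  -- In a basis of V, F becomes a family of scalar polynomials; each vanishes at every point, hence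
  -- is zero since k is infinite.
  apply (TensorProduct.equivFinsuppOfBasisRight (M := MvPolynomial σ k) b).injective
  rw [map_zero]
  ext1 i
  apply MvPolynomial.funext
  intro t
  have key : (MvPolynomial.aeval t).toLinearMap ∘ₗ Finsupp.lapply i ∘ₗ
      (TensorProduct.equivFinsuppOfBasisRight (M := MvPolynomial σ k) b).toLinearMap =
      b.coord i ∘ₗ (TensorProduct.lid k V).toLinearMap ∘ₗ
        (MvPolynomial.aeval t).toLinearMap.rTensor V := by
    refine TensorProduct.ext' fun p v => ?_
    simp [mul_comm]
  have := LinearMap.congr_fun key F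
  simp only [LinearMap.comp_apply, LinearEquiv.coe_coe, h t, map_zero] at this
  simpa [MvPolynomial.aeval_eq_eval] using this

/-- C is a quotient of the polynomial ring on its own elements, so polynomial coefficients suffice.
There every specialization of the variables to scalars is a homomorphism to B, which kills the value
of f. -/
theorem IsIdentity.scalarExt {k : Type u} [Field k] [Infinite k] {Ω : Type v} (C : Type w₁)
    [CommRing C] [Algebra k C] {B : OpAlg.{u, v, w₂} k Ω} {f : polyAlg k Ω ℕ}
    (hf : IsIdentity B f) : IsIdentity (scalarExt C B) f := by
  have hs : Function.Surjective (MvPolynomial.aeval (R := k) (id : C → C)) := fun c =>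
    ⟨MvPolynomial.X c, by simp⟩
  refine (isHom_rTensor (MvPolynomial.aeval (R := k) (id : C → C)) B).isIdentity_of_surjective
    (LinearMap.rTensor_surjective _ hs) fun a => ?_
  refine eq_zero_of_lid_rTensor_aeval _ fun t => ?_
  exact ((isHom_lid_rTensor (MvPolynomial.aeval t) B).map_evalPoly a f).trans (hf _)

/-! ### Pre-commutative algebras -/

/-- An algebra with one operation is pre-commutative. -/
class IsPreCom {k : Type u} [Field k] (Z : OpAlg.{u, 0, w} k Unit) : Prop where
  add_mul_eq : ∀ x y z : Z, Z.op () (Z.op () x y + Z.op () y x) z = Z.op () x (Z.op () y z)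

theorem evalPoly_preComIdentity {k : Type u} [Field k] (Z : OpAlg.{u, 0, w} k Unit)
    (a : ℕ → Z) {f : polyAlg k Unit ℕ} (hf : f ∈ preComIdentities k) :
    evalPoly Z a f = Z.op () (Z.op () (a 0) (a 1) + Z.op () (a 1) (a 0)) (a 2) -
      Z.op () (a 0) (Z.op () (a 1) (a 2)) := by
  obtain rfl := hf
  simp only [map_sub, (isHom_evalPoly Z a) (), map_add, LinearMap.add_apply, evalPoly_polyVar]

instance isPreCom_freePreCom (k : Type u) [Field k] (m : ℕ) : IsPreCom (freePreCom k m) where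
  add_mul_eq x y z := by
    obtain ⟨x, rfl⟩ := Submodule.mkQ_surjective _ x
    obtain ⟨y, rfl⟩ := Submodule.mkQ_surjective _ y
    obtain ⟨z, rfl⟩ := Submodule.mkQ_surjective _ z
    let P := polyAlg k Unit (Fin m)
    have h : P.op () (P.op () x y + P.op () y x) z - P.op () x (P.op () y z) ∈
        identityIdeal (preComIdentities k) (Fin m) := by
      rw [identityIdeal, Submodule.mem_sInf]
      rintro I ⟨-, hI⟩
      -- Only the variables 0, 1, 2 occur in the identity; the value z at the others is arbitrary.
      have := hI _ rfl fun i => if i = 0 then x else if i = 1 then y else z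
      rw [evalPoly_preComIdentity P _ rfl] at this
      simpa using this
    exact (Submodule.Quotient.eq _).2 h

/-- The homomorphism from a free pre-commutative algebra that extends a map of the generators. -/
def freePreComLift {k : Type u} [Field k] {m : ℕ} (Z : OpAlg.{u, 0, w} k Unit) [IsPreCom Z]
    (a : Fin m → Z) : freePreCom k m →ₗ[k] Z :=
  (identityIdeal (preComIdentities k) (Fin m)).liftQ (evalPoly Z a) (by
    -- The kernel of evaluation is one of the ideals in the infimum that defines `identityIdeal`.
    refine sInf_le ⟨fun ω p q hp => ?_, fun f hf s => ?_⟩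
    · rw [LinearMap.mem_ker] at hp ⊢
      rw [LinearMap.mem_ker, isHom_evalPoly Z a, isHom_evalPoly Z a, hp]
      simp
    · rw [LinearMap.mem_ker, (isHom_evalPoly Z a).map_evalPoly, evalPoly_preComIdentity Z _ hf,
        IsPreCom.add_mul_eq, sub_self])

theorem isHom_freePreComLift {k : Type u} [Field k] {m : ℕ} (Z : OpAlg.{u, 0, w} k Unit)
    [IsPreCom Z] (a : Fin m → Z) : IsHom (freePreComLift Z a) := by
  intro ω x y
  obtain ⟨x, rfl⟩ := Submodule.mkQ_surjective _ x
  obtain ⟨y, rfl⟩ := Submodule.mkQ_surjective _ y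
  exact isHom_evalPoly Z a ω x y

theorem exists_freePreComLift_eq {k : Type u} [Field k] {m : ℕ} (Z : OpAlg.{u, 0, w} k Unit)
    [IsPreCom Z] (a : Fin m → Z) (i : Fin m) : ∃ z, freePreComLift Z a z = a i :=
  ⟨Submodule.mkQ _ (polyVar k Unit i), evalPoly_polyVar Z a i⟩

/-! ### The commutative algebra of a pre-commutative algebra and its regular module -/

/-- The split null extension of the commutative associative algebra `(Z, zw + wz)` by its module
`Z`, on which it acts by left multiplications in `Z`. -/
def ComDouble {k : Type u} [Field k] (Z : OpAlg.{u, 0, w} k Unit) : Type w := Z × Z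

instance {k : Type u} [Field k] (Z : OpAlg.{u, 0, w} k Unit) : AddCommGroup (ComDouble Z) :=
  inferInstanceAs (AddCommGroup (Z × Z))

instance {k : Type u} [Field k] (Z : OpAlg.{u, 0, w} k Unit) : Module k (ComDouble Z) :=
  inferInstanceAs (Module k (Z × Z))

namespace ComDouble

section

variable {k : Type u} [Field k] (Z : OpAlg.{u, 0, w} k Unit)

/-- The first projection. -/
def fst : ComDouble Z →ₗ[k] Z := LinearMap.fst k Z Z

/-- The second projection. -/
def snd : ComDouble Z →ₗ[k] Z := LinearMap.snd k Z Z

/-- The first inclusion. -/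
def inl : Z →ₗ[k] ComDouble Z := LinearMap.inl k Z Z

/-- The second inclusion. -/
def inr : Z →ₗ[k] ComDouble Z := LinearMap.inr k Z Z

variable {Z}

@[simp] theorem fst_inl (z : Z) : fst Z (inl Z z) = z := rfl

@[simp] theorem snd_inl (z : Z) : snd Z (inl Z z) = 0 := rfl

@[simp] theorem fst_inr (z : Z) : fst Z (inr Z z) = 0 := rfl

@[simp] theorem snd_inr (z : Z) : snd Z (inr Z z) = z := rfl

theorem ext {p q : ComDouble Z} (h₁ : fst Z p = fst Z q) (h₂ : snd Z p = snd Z q) : p = q :=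
  Prod.ext h₁ h₂

instance : Mul (ComDouble Z) :=
  ⟨fun p q => inl Z (Z.op () (fst Z p) (fst Z q) + Z.op () (fst Z q) (fst Z p)) +
    inr Z (Z.op () (fst Z p) (snd Z q) + Z.op () (fst Z q) (snd Z p))⟩

theorem mul_def (p q : ComDouble Z) :
    p * q = inl Z (Z.op () (fst Z p) (fst Z q) + Z.op () (fst Z q) (fst Z p)) +
      inr Z (Z.op () (fst Z p) (snd Z q) + Z.op () (fst Z q) (snd Z p)) := rfl

@[simp] theorem fst_mul (p q : ComDouble Z) :
    fst Z (p * q) = Z.op () (fst Z p) (fst Z q) + Z.op () (fst Z q) (fst Z p) := by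
  simp [mul_def]

@[simp] theorem snd_mul (p q : ComDouble Z) :
    snd Z (p * q) = Z.op () (fst Z p) (snd Z q) + Z.op () (fst Z q) (snd Z p) := by
  simp [mul_def]

end

end ComDouble

/-- The left side of the defining identity is symmetric in x and y, so left multiplications commute.
-/
theorem IsPreCom.left_comm {k : Type u} [Field k] (Z : OpAlg.{u, 0, w} k Unit) [IsPreCom Z]
    (x y z : Z) : Z.op () x (Z.op () y z) = Z.op () y (Z.op () x z) := by
  rw [← IsPreCom.add_mul_eq, add_comm, IsPreCom.add_mul_eq]

namespace ComDouble

variable {k : Type u} [Field k] (Z : OpAlg.{u, 0, w} k Unit) [IsPreCom Z]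

instance : NonUnitalCommRing (ComDouble Z) :=
  { (inferInstance : AddCommGroup (ComDouble Z)), (inferInstance : Mul (ComDouble Z)) with
    left_distrib := fun a b c => by
      apply ext <;> simp only [fst_mul, snd_mul, map_add, LinearMap.add_apply] <;> abel
    right_distrib := fun a b c => by
      apply ext <;> simp only [fst_mul, snd_mul, map_add, LinearMap.add_apply] <;> abel
    zero_mul := fun a => by apply ext <;> simp
    mul_zero := fun a => by apply ext <;> simp
    mul_comm := fun a b => by
      apply ext <;> simp only [fst_mul, snd_mul, add_comm]
    mul_assoc := fun a b c => by
      apply ext <;> simp only [fst_mul, snd_mul, IsPreCom.add_mul_eq]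
      · simp only [map_add]
        rw [IsPreCom.left_comm Z (fst Z c) (fst Z a), IsPreCom.left_comm Z (fst Z c) (fst Z b)]
        abel
      · simp only [map_add]
        rw [IsPreCom.left_comm Z (fst Z c) (fst Z a), IsPreCom.left_comm Z (fst Z c) (fst Z b)]
        abel }

instance : IsScalarTower k (ComDouble Z) (ComDouble Z) where
  smul_assoc c p q := by
    apply ext <;> simp

instance : SMulCommClass k (ComDouble Z) (ComDouble Z) where
  smul_comm c p q := by
    apply ext <;> simp

end ComDouble

/-! ### Transfer of identities from A ⋉ M to Z ⊠ (A ⋌ M) -/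

/-- The embedding of `Z ⊠ (A ⋌ M)` into an extension of scalars of `A ⋉ M`. -/
def boxtimesEmb {k : Type u} [Field k] {Ω : Type v} (Z : OpAlg.{u, 0, w} k Unit) [IsPreCom Z]
    (A : OpAlg.{u, v, w₁} k Ω) (M : BimodData.{u, v, w₁, w₂} A) :
    Z ⊗[k] (A × M) →ₗ[k] Unitization k (ComDouble Z) ⊗[k] (A × M) :=
  TensorProduct.map (Unitization.inrHom k k (ComDouble Z) ∘ₗ ComDouble.inl Z)
      (LinearMap.inl k A M ∘ₗ LinearMap.fst k A M) +
    TensorProduct.map (Unitization.inrHom k k (ComDouble Z) ∘ₗ ComDouble.inr Z)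
      (LinearMap.inr k A M ∘ₗ LinearMap.snd k A M)

theorem ComDouble.inl_mul_inl {k : Type u} [Field k] {Z : OpAlg.{u, 0, w} k Unit} (z w : Z) :
    ComDouble.inl Z z * ComDouble.inl Z w = ComDouble.inl Z (Z.op () z w + Z.op () w z) := by
  apply ext <;> simp

theorem ComDouble.inl_mul_inr {k : Type u} [Field k] {Z : OpAlg.{u, 0, w} k Unit} (z w : Z) :
    ComDouble.inl Z z * ComDouble.inr Z w = ComDouble.inr Z (Z.op () z w) := by
  apply ext <;> simp

theorem ComDouble.inr_mul_inl {k : Type u} [Field k] {Z : OpAlg.{u, 0, w} k Unit} (z w : Z) :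
    ComDouble.inr Z z * ComDouble.inl Z w = ComDouble.inr Z (Z.op () w z) := by
  apply ext <;> simp

theorem ComDouble.inr_mul_inr {k : Type u} [Field k] {Z : OpAlg.{u, 0, w} k Unit} (z w : Z) :
    ComDouble.inr Z z * ComDouble.inr Z w = 0 := by
  apply ext <;> simp

theorem boxtimesEmb_tmul {k : Type u} [Field k] {Ω : Type v} (Z : OpAlg.{u, 0, w} k Unit)
    [IsPreCom Z] (A : OpAlg.{u, v, w₁} k Ω) (M : BimodData.{u, v, w₁, w₂} A) (z : Z)
    (p : A × M) : boxtimesEmb Z A M (z ⊗ₜ p) =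
      (ComDouble.inl Z z : Unitization k (ComDouble Z)) ⊗ₜ[k] ((p.1, 0) : A × M) +
        (ComDouble.inr Z z : Unitization k (ComDouble Z)) ⊗ₜ[k] ((0, p.2) : A × M) := rfl

/-- The coefficients match: a ∘ b receives zw + wz, l(a, v) receives the action zw of z on w, and
r(u, b) receives wz. The product of two second components is zero. -/
theorem isHom_boxtimesEmb {k : Type u} [Field k] {Ω : Type v} (Z : OpAlg.{u, 0, w} k Unit)
    [IsPreCom Z] (A : OpAlg.{u, v, w₁} k Ω) (M : BimodData.{u, v, w₁, w₂} A) :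
    IsHom (A := boxtimes Z (oneSided A M))
      (B := scalarExt (Unitization k (ComDouble Z)) (splitNull A M)) (boxtimesEmb Z A M) := by
  refine isHom_of_tmul _ _ _ fun ω z p z' p' => ?_
  simp only [LinearMap.add_apply, TensorProduct.map₂_apply_tmul, TensorProduct.map_tmul, map_add,
    boxtimesEmb_tmul,
    LinearMap.mk₂_apply, LinearMap.mul_apply', ← Unitization.inr_mul, ComDouble.inl_mul_inl,
    ComDouble.inl_mul_inr, ComDouble.inr_mul_inl, ComDouble.inr_mul_inr, LinearMap.flip_apply,
    map_zero, LinearMap.zero_apply, add_zero, zero_add, Unitization.inr_zero,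
    TensorProduct.zero_tmul, Unitization.inr_add, TensorProduct.add_tmul]
  abel

theorem boxtimesEmb_injective {k : Type u} [Field k] {Ω : Type v} (Z : OpAlg.{u, 0, w} k Unit)
    [IsPreCom Z] (A : OpAlg.{u, v, w₁} k Ω) (M : BimodData.{u, v, w₁, w₂} A) :
    Function.Injective (boxtimesEmb Z A M) := by
  -- A left inverse: read z off the first component on A and off the second on M.
  let g : Unitization k (ComDouble Z) ⊗[k] (A × M) →ₗ[k] Z ⊗[k] (A × M) :=
    TensorProduct.map (ComDouble.fst Z ∘ₗ Unitization.sndHom k k (ComDouble Z))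
      (LinearMap.inl k A M ∘ₗ LinearMap.fst k A M) +
    TensorProduct.map (ComDouble.snd Z ∘ₗ Unitization.sndHom k k (ComDouble Z))
      (LinearMap.inr k A M ∘ₗ LinearMap.snd k A M)
  have h : g ∘ₗ boxtimesEmb Z A M = LinearMap.id := by
    refine TensorProduct.ext' fun z p => ?_
    simp [g, boxtimesEmb, ← TensorProduct.tmul_add]
  exact Function.LeftInverse.injective (g := g) (LinearMap.congr_fun h)

/-! ### Polynomials without constant term -/

/-- The bilinear operation `(f, g) ↦ ∫₀ˣ f g'` on `x k[x]`; the basis vector `n` stands for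
`x ^ (n + 1)`. -/
def integralOp (k : Type u) [Field k] : (ℕ →₀ k) →ₗ[k] (ℕ →₀ k) →ₗ[k] (ℕ →₀ k) :=
  Finsupp.linearCombination k fun a : ℕ => Finsupp.linearCombination k fun b : ℕ =>
    -- ∫₀ˣ of x^(a+1) · (b+1) x^b, with exponents shifted by one in the index.
    Finsupp.single (a + b + 1) ((b + 1 : k) / (a + b + 2))

theorem integralOp_single (k : Type u) [Field k] (a b : ℕ) :
    integralOp k (Finsupp.single a 1) (Finsupp.single b 1) =
      ((b + 1 : k) / (a + b + 2)) • Finsupp.single (a + b + 1) 1 := by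
  simp [integralOp, Finsupp.linearCombination_single]

/-- The space `x k[x]` with the operation `(f, g) ↦ ∫₀ˣ f g'`. -/
def integralAlg (k : Type u) [Field k] : OpAlg.{u, 0, u} k Unit where
  carrier := ℕ →₀ k
  op _ := integralOp k

/-- The power `x ^ (n + 1)`. -/
def integralAlg.pow (k : Type u) [Field k] (n : ℕ) : integralAlg k := Finsupp.single n (1 : k)

theorem integralAlg.pow_op_pow (k : Type u) [Field k] (a b : ℕ) :
    (integralAlg k).op () (pow k a) (pow k b) =
      ((b + 1 : k) / (a + b + 2)) • pow k (a + b + 1) :=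
  integralOp_single k a b

theorem integralAlg.induction {k : Type u} [Field k] {p : integralAlg k → Prop}
    (x : integralAlg k) (zero : p 0) (add : ∀ x y, p x → p y → p (x + y))
    (smul_pow : ∀ (c : k) (n : ℕ), p (c • pow k n)) : p x := by
  refine Finsupp.induction_linear (motive := p) x zero add fun n c => ?_
  have h : c • pow k n = (Finsupp.single n c : ℕ →₀ k) :=
    (Finsupp.smul_single c n (1 : k)).trans (by rw [smul_eq_mul, mul_one])
  exact h ▸ smul_pow c n

theorem cast_add_add_two_ne_zero (k : Type u) [Field k] [CharZero k] (a b : ℕ) :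
    (a + b + 2 : k) ≠ 0 := by
  exact_mod_cast (by omega : a + b + 2 ≠ 0)

/-- Integration by parts gives ∫ f g' + ∫ g f' = f g, without boundary term because f(0) = g(0) = 0.
Both sides of the identity are then ∫ f g h'. -/
instance (k : Type u) [Field k] [CharZero k] : IsPreCom (integralAlg k) where
  add_mul_eq x y z := by
    induction x using integralAlg.induction with
    | zero => simp
    | add x x' hx hx' =>
      simp only [map_add, LinearMap.add_apply] at hx hx' ⊢
      rw [← hx, ← hx']
      abel
    | smul_pow c a =>
    induction y using integralAlg.induction with
    | zero => simp
    | add y y' hy hy' =>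
      simp only [map_add, LinearMap.add_apply] at hy hy' ⊢
      rw [← hy, ← hy']
      abel
    | smul_pow c' b =>
    induction z using integralAlg.induction with
    | zero => simp
    | add z z' hz hz' => rw [LinearMap.map_add _ z z', hz, hz', map_add, map_add]
    | smul_pow c'' d =>
      have h₁ := cast_add_add_two_ne_zero k a b
      have h₂ := cast_add_add_two_ne_zero k b a
      have h₃ := cast_add_add_two_ne_zero k b d
      have h₄ := cast_add_add_two_ne_zero k (a + b + 1) d
      have h₅ := cast_add_add_two_ne_zero k a (b + d + 1)
      push_cast at h₄ h₅
      simp only [map_smul, LinearMap.smul_apply, map_add, LinearMap.add_apply,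
        integralAlg.pow_op_pow]
      rw [show b + a + 1 + d + 1 = a + b + 1 + d + 1 by omega,
        show a + (b + d + 1) + 1 = a + b + 1 + d + 1 by omega, add_comm b a]
      simp only [smul_smul, ← add_smul]
      congr 1
      push_cast
      field_simp
      ring

/-- The value at `1`, as a linear functional. -/
def integralAlg.evalOne (k : Type u) [Field k] : integralAlg k →ₗ[k] k :=
  Finsupp.linearCombination k fun _ : ℕ => (1 : k)

/-- The value of the derivative at `1`, as a linear functional. -/
def integralAlg.derivOne (k : Type u) [Field k] : integralAlg k →ₗ[k] k :=
  Finsupp.linearCombination k fun n : ℕ => (n + 1 : k)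

theorem integralAlg.evalOne_pow (k : Type u) [Field k] (n : ℕ) : evalOne k (pow k n) = 1 :=
  (Finsupp.linearCombination_single k 1 n).trans (one_smul k _)

theorem integralAlg.derivOne_pow (k : Type u) [Field k] (n : ℕ) :
    derivOne k (pow k n) = n + 1 :=
  (Finsupp.linearCombination_single k 1 n).trans (one_smul k _)

/-- Integration by parts again: the symmetrized product is f g, and evaluation at 1 is
multiplicative. -/
theorem integralAlg.evalOne_add {k : Type u} [Field k] [CharZero k] (x y : integralAlg k) :
    evalOne k ((integralAlg k).op () x y) + evalOne k ((integralAlg k).op () y x) =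
      evalOne k x * evalOne k y := by
  induction x using integralAlg.induction with
  | zero => simp
  | add x x' hx hx' =>
    simp only [map_add, LinearMap.add_apply, add_mul, ← hx, ← hx']
    abel
  | smul_pow c a =>
  induction y using integralAlg.induction with
  | zero => simp
  | add y y' hy hy' =>
    simp only [map_add, LinearMap.add_apply, mul_add, ← hy, ← hy']
    abel
  | smul_pow c' b =>
    have h₁ := cast_add_add_two_ne_zero k a b
    have h₂ := cast_add_add_two_ne_zero k b a
    simp only [map_smul, LinearMap.smul_apply, pow_op_pow, evalOne_pow, smul_eq_mul]
    field_simp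
    ring

/-- The derivative of ∫₀ˣ f g' is f g'. -/
theorem integralAlg.derivOne_op {k : Type u} [Field k] [CharZero k] (x y : integralAlg k) :
    derivOne k ((integralAlg k).op () x y) = evalOne k x * derivOne k y := by
  induction x using integralAlg.induction with
  | zero => simp
  | add x x' hx hx' =>
    simp only [map_add, LinearMap.add_apply, add_mul, ← hx, ← hx']
  | smul_pow c a =>
  induction y using integralAlg.induction with
  | zero => simp
  | add y y' hy hy' =>
    simp only [map_add, mul_add, ← hy, ← hy']
  | smul_pow c' b =>
    have h := cast_add_add_two_ne_zero k a b
    simp only [map_smul, LinearMap.smul_apply, pow_op_pow, evalOne_pow, derivOne_pow, smul_eq_mul]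
    push_cast
    field_simp
    ring

/-! ### Transfer of identities from Z ⊠ (A ⋌ M) to A ⋉ M -/

/-- A homomorphism of `Z ⊠ (A ⋌ M)` to `A ⋉ M` is given by two functionals on `Z`: a
multiplicative one for `zw + wz`, and a derivation along it. -/
def boxtimesProj {k : Type u} [Field k] {Ω : Type v} {Z : OpAlg.{u, 0, w} k Unit}
    (ε δ : Z →ₗ[k] k) (A : OpAlg.{u, v, w₁} k Ω) (M : BimodData.{u, v, w₁, w₂} A) :
    Z ⊗[k] (A × M) →ₗ[k] A × M :=
  (TensorProduct.lid k (A × M)).toLinearMap ∘ₗ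
    (TensorProduct.map ε (LinearMap.inl k A M ∘ₗ LinearMap.fst k A M) +
      TensorProduct.map δ (LinearMap.inr k A M ∘ₗ LinearMap.snd k A M))

theorem boxtimesProj_tmul {k : Type u} [Field k] {Ω : Type v} {Z : OpAlg.{u, 0, w} k Unit}
    (ε δ : Z →ₗ[k] k) (A : OpAlg.{u, v, w₁} k Ω) (M : BimodData.{u, v, w₁, w₂} A) (z : Z)
    (p : A × M) : boxtimesProj ε δ A M (z ⊗ₜ p) = (ε z • p.1, δ z • p.2) := by
  simp [boxtimesProj]

theorem isHom_boxtimesProj {k : Type u} [Field k] {Ω : Type v} {Z : OpAlg.{u, 0, w} k Unit}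
    {ε δ : Z →ₗ[k] k} (hε : ∀ x y, ε (Z.op () x y) + ε (Z.op () y x) = ε x * ε y)
    (hδ : ∀ x y, δ (Z.op () x y) = ε x * δ y) (A : OpAlg.{u, v, w₁} k Ω)
    (M : BimodData.{u, v, w₁, w₂} A) :
    IsHom (A := boxtimes Z (oneSided A M)) (B := splitNull A M) (boxtimesProj ε δ A M) := by
  refine isHom_of_tmul _ _ _ fun ω z p z' p' => ?_
  simp only [LinearMap.add_apply, TensorProduct.map₂_apply_tmul, TensorProduct.map_tmul, map_add,
    boxtimesProj_tmul,
    LinearMap.mk₂_apply, LinearMap.flip_apply, Prod.mk_add_mk, ← add_smul, hε, hδ, map_smul,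
    LinearMap.smul_apply, smul_smul, mul_comm (ε z')]
  simp only [mul_comm]

theorem boxtimesProj_surjective {k : Type u} [Field k] {Ω : Type v} {Z : OpAlg.{u, 0, w} k Unit}
    {ε δ : Z →ₗ[k] k} {z : Z} (hε : ε z = 1) (hδ : δ z = 1) (A : OpAlg.{u, v, w₁} k Ω)
    (M : BimodData.{u, v, w₁, w₂} A) : Function.Surjective (boxtimesProj ε δ A M) := fun p =>
  ⟨z ⊗ₜ p, by rw [boxtimesProj_tmul, hε, hδ, one_smul, one_smul]⟩

theorem isIdentity_boxtimes_iff {k : Type u} [Field k] [CharZero k] {Ω : Type v}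
    (A : OpAlg.{u, v, w₁} k Ω) (M : BimodData.{u, v, w₁, w₂} A) {m : ℕ} (hm : 1 ≤ m)
    (f : polyAlg k Ω ℕ) :
    IsIdentity (boxtimes (freePreCom k m) (oneSided A M)) f ↔ IsIdentity (splitNull A M) f := by
  constructor
  -- Every generator goes to x (index 0), whose value and derivative at 1 are both 1; hence one z
  -- serves for surjectivity on A and on M. A generator exists as m ≥ 1.
  · let φ := freePreComLift (m := m) (integralAlg k) fun _ => integralAlg.pow k 0
    have hφ : IsHom φ := isHom_freePreComLift _ _
    obtain ⟨z, hz⟩ : ∃ z, φ z = integralAlg.pow k 0 := exists_freePreComLift_eq _ _ ⟨0, hm⟩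
    refine (isHom_boxtimesProj (ε := integralAlg.evalOne k ∘ₗ φ) (δ := integralAlg.derivOne k ∘ₗ φ)
      (fun x y => ?_) (fun x y => ?_) A M).isIdentity_of_surjective
      (boxtimesProj_surjective (z := z) ?_ ?_ A M)
    · simp only [LinearMap.comp_apply, hφ (), integralAlg.evalOne_add]
    · simp only [LinearMap.comp_apply, hφ (), integralAlg.derivOne_op]
    · rw [LinearMap.comp_apply, hz, integralAlg.evalOne_pow]
    · rw [LinearMap.comp_apply, hz, integralAlg.derivOne_pow, Nat.cast_zero, zero_add]
  · intro hf
    exact (isHom_boxtimesEmb (freePreCom k m) A M).isIdentity_of_injective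
      (boxtimesEmb_injective _ A M) (hf.scalarExt _)

end VarAlg

end

theorem proposition1 {k : Type u} [Field k] [CharZero k] {Ω : Type v}
    (E : Set (VarAlg.polyAlg k Ω ℕ))
    (A : VarAlg.OpAlg.{u, v, w₁} k Ω) (hA : A ∈ VarAlg.variety E)
    (M : VarAlg.BimodData.{u, v, w₁, w₂} A) (hM : VarAlg.IsBimodule E M)
    (m : ℕ) (hm : 1 ≤ m) :
    VarAlg.Var.{u, v, w, max u w₁ w₂}
        (VarAlg.boxtimes (VarAlg.freePreCom k m) (VarAlg.oneSided A M)) =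
      VarAlg.Var.{u, v, w, max w₁ w₂} (VarAlg.splitNull A M) := by
  have h : {f | VarAlg.IsIdentity
      (VarAlg.boxtimes (VarAlg.freePreCom k m) (VarAlg.oneSided A M)) f} =
      {f | VarAlg.IsIdentity (VarAlg.splitNull A M) f} :=
    Set.ext fun f => VarAlg.isIdentity_boxtimes_iff A M hm f
  rw [VarAlg.Var, VarAlg.Var, h]
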